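/- Let $\mathbb N=\{1,2,\dots\}$. A sequence $a:\mathbb N\to\mathbb R$ is called $\delta$-scattered, where $\delta\in(0,1]$, if there exists $\epsilon>0$ such that for every sufficiently large $N$, $$\frac1{N^2}\sum_{1\le m<n\le N}\min\big(|a(n)-a(m)|^{-\delta},1\big)\le\frac1{(\log N)^{1+\epsilon}},$$ where $\min(0^{-\delta},1)=1$ by convention; it is called scattered if it is $\delta$-scattered for every $\delta\in(0,1]$. A sequence $(x_n)_{n\in\mathbb N}$ in $\mathbb R^k$ is uniformly distributed in $\mathbb T^k=\mathbb R^k/\mathbb Z^k$ if for all intervals $I_1,\dots,I_k\subset[0,1]$ the proportion of $n\in\{1,\dots,N\}$ for which the vector of coordinatewise fractional parts $\{x_n\}$ lies in $I_1\times\cdots\times I_k$ tends, as $N\to\infty$, to the $k$-dimensional Lebesgue measure of $I_1\times\cdots\times I_k$. **Theorem.** Let $k\in\mathbb N$ and let $f_1,\dots,f_k:\mathbb R\to\mathbb R$ be real-analytic functions. Then the following are equivalent: 1. The functions $1,f_1,\dots,f_k$ are linearly independent over $\mathbb R$ (as a family: the only real $c_0,\dots,c_k$ with $c_0+c_1f_1+\dots+c_kf_k=0$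 identically are $c_0=\dots=c_k=0$). 2. For all scattered sequences $a_1,\dots,a_k:\mathbb N\to\mathbb R$, for Lebesgue-almost every $x\in\mathbb R$, the sequence $\big(a_1(n)f_1(x),\dots,a_k(n)f_k(x)\big)_{n\in\mathbb N}$ is uniformly distributed in $\mathbb T^k$. In particular, for all polynomials $p_1,\dots,p_k\in\mathbb R[x]$, the family $1,p_1,\dots,p_k$ is linearly independent over $\mathbb R$ in $\mathbb R[x]$ if and only if for all scattered sequences $a_1,\dots,a_k:\mathbb N\to\mathbb R$, for Lebesgue-almost every $x\in\mathbb R$, the sequence $\big(a_1(n)p_1(x),\dots,a_k(n)p_k(x)\big)_{n\in\mathbb N}$ is uniformly distributed in $\mathbb T^k$. -/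

import Mathlib

open MeasureTheory Filter Topology

noncomputable section

/-- The truncated inverse power `min (t ^ (-δ)) 1` of a distance `t ≥ 0`, with the convention
`0 ^ (-δ) = ∞`, so that its value at `t = 0` is `1`. -/
def truncInvPow (δ t : ℝ) : ℝ :=
  if t = 0 then 1 else min (t ^ (-δ)) 1

/-- A sequence `a(1), a(2), …` is `δ`-scattered if there is `ε > 0` such that for all large `N`,
`N⁻² ∑_{1 ≤ m < n ≤ N} min (|a(n) - a(m)| ^ (-δ)) 1 ≤ 1 / (log N) ^ (1 + ε)`.
The value of `a` at the index `0` plays no role. -/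
def IsDeltaScattered (δ : ℝ) (a : ℕ → ℝ) : Prop :=
  ∃ ε : ℝ, 0 < ε ∧ ∀ᶠ N : ℕ in atTop,
    1 / (N : ℝ) ^ 2 * ∑ n ∈ Finset.Icc 1 N, ∑ m ∈ Finset.Ico 1 n, truncInvPow δ |a n - a m|
      ≤ 1 / Real.log N ^ (1 + ε)

/-- A sequence is scattered if it is `δ`-scattered for every `δ ∈ (0, 1]`. -/
def IsScattered (a : ℕ → ℝ) : Prop :=
  ∀ δ : ℝ, 0 < δ → δ ≤ 1 → IsDeltaScattered δ a

/-- A sequence `x(1), x(2), …` in `ℝᵏ` is uniformly distributed modulo one: for all intervals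
`I₁, …, I_k ⊆ [0, 1]` (open, closed, half-open or degenerate), the proportion of `n ∈ {1, …, N}`
for which the vector of fractional parts of `x(n)` lies in `I₁ × ⋯ × I_k` tends to the
`k`-dimensional Lebesgue measure of this box.
The value of `x` at the index `0` plays no role. -/
def IsUniformlyDistributedModOne {k : ℕ} (x : ℕ → Fin k → ℝ) : Prop :=
  ∀ I : Fin k → Set ℝ, (∀ i, (I i).OrdConnected ∧ I i ⊆ Set.Icc 0 1) →
    Tendsto
      (fun N : ℕ => 1 / (N : ℝ) *
        ({n : ℕ | n ∈ Set.Icc 1 N ∧ (fun i => Int.fract (x n i)) ∈ Set.univ.pi I}.ncard : ℝ))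
      atTop (𝓝 (volume (Set.univ.pi I)).toReal)

end

/-!
For the forward implication fix scattered sequences `a i` and a nonzero frequency vector `h`. By
Weyl's criterion (`isUniformlyDistributedModOne_of_tendsto`) it suffices that the averages of
`exp (2πi ∑ hᵢ aᵢ(n) fᵢ(x))` tend to zero for almost every `x`. Expanding the square, the second
moment of such an average over a short interval is a sum of oscillatory integrals with phases
`∑ cᵢ fᵢ`, where `cᵢ = 2π hᵢ (aᵢ(n) - aᵢ(m))`.

Since `1, f₁, …, f_k` are independent and analytic, for `c ≠ 0` some derivative of positive order of
`∑ cᵢ fᵢ` is nonzero at each point. Compactness of the unit sphere and van der Corput's estimate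
(`exists_norm_integral_cexp_le_rpow`) bound these integrals by a constant times `‖c‖ ^ (-δ)`, with
one `δ > 0` for all `c` (`exists_norm_integral_cexp_sum_le`). For an index `i` with `hᵢ ≠ 0` this is
at most a constant times `min (|aᵢ(n) - aᵢ(m)| ^ (-δ)) 1`, so scatteredness of the single sequence
`aᵢ` bounds the second moment by a constant times `(log N) ^ (-(1 + ε))`. These bounds are summable
along `N = ⌈exp (j ^ β)⌉` for a suitable `β < 1`, so the averages vanish almost everywhere along
this subsequence, and hence along all `N` because consecutive terms have ratio tending to one
(`ae_tendsto_average_of_integral_norm_sq_le`). The exponent `δ` and the interval depend on the point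
around which one works, which is harmless for a statement about almost every `x`.

Conversely, a relation `c₀ + ∑ cᵢ fᵢ = 0` can be scaled so that `c₀` is an integer. The sequences
`cᵢ 2ⁿ` are scattered when `cᵢ ≠ 0`, and `∑ cᵢ 2ⁿ fᵢ(x)` is an integer for all `n` and `x`, so the
fractional parts of the coordinates with `cᵢ ≠ 0` never all lie in `(0, 1 / k)`
(`exists_isScattered_not_isUniformlyDistributedModOne`).
-/

/-! ### Van der Corput estimates for phases with a nonvanishing derivative -/

/-- One integration by parts bounds an oscillatory integral whose phase has no critical point. The
phase derivative need not be monotone: the bound `M` on its derivative replaces this. -/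
lemma norm_integral_cexp_le_of_abs_deriv_ge {g g' g'' : ℝ → ℝ} {a b η M lam : ℝ} (hab : a ≤ b)
    (hg : ∀ x, HasDerivAt g (g' x) x) (hg' : ∀ x, HasDerivAt g' (g'' x) x)
    (hg'' : Continuous g'') (hη : 0 < η) (hlow : ∀ x ∈ Set.Icc a b, η ≤ |g' x|)
    (hM : ∀ x ∈ Set.Icc a b, |g'' x| ≤ M) (hlam : 0 < lam) :
    ‖∫ x in a..b, Complex.exp (Complex.I * (lam * g x : ℝ))‖
      ≤ 2 / (lam * η) + M / (lam * η ^ 2) * (b - a) := by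
  have hne : ∀ x ∈ Set.Icc a b, g' x ≠ 0 := fun x hx h => by
    have := hlow x hx
    rw [h, abs_zero] at this
    linarith
  have hcg : Continuous g := continuous_iff_continuousAt.2 fun x => (hg x).continuousAt
  have hcg' : Continuous g' := continuous_iff_continuousAt.2 fun x => (hg' x).continuousAt
  have hnorm : ∀ t : ℝ, ‖Complex.exp (Complex.I * (t : ℝ))‖ = 1 := fun t => by
    rw [mul_comm]; exact Complex.norm_exp_ofReal_mul_I t
  set E : ℝ → ℂ := fun x => Complex.exp (Complex.I * (lam * g x : ℝ)) with hE
  have hcE : Continuous E := by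
    rw [hE]; fun_prop
  have hdE : ∀ x, HasDerivAt E (E x * (Complex.I * ((lam * g' x : ℝ) : ℂ))) x := fun x =>
    ((((hg x).const_mul lam).ofReal_comp).const_mul Complex.I).cexp
  -- the primitive suggested by one integration by parts
  set F : ℝ → ℂ := fun x => E x / (Complex.I * ((lam * g' x : ℝ) : ℂ)) with hF
  set R : ℝ → ℂ := fun x => E x * ((g'' x / (lam * g' x ^ 2) : ℝ) : ℂ) / Complex.I with hR
  have hdF : ∀ x ∈ Set.uIcc a b, HasDerivAt F (E x - R x) x := by
    intro x hx
    rw [Set.uIcc_of_le hab] at hx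
    have h0 : (g' x : ℂ) ≠ 0 := by exact_mod_cast hne x hx
    have hl : (lam : ℂ) ≠ 0 := by exact_mod_cast hlam.ne'
    have hden : Complex.I * ((lam * g' x : ℝ) : ℂ) ≠ 0 := by
      push_cast
      exact mul_ne_zero Complex.I_ne_zero (mul_ne_zero hl h0)
    have := (hdE x).div ((((hg' x).const_mul lam).ofReal_comp).const_mul Complex.I) hden
    refine this.congr_deriv ?_
    simp only [hR]
    push_cast
    have hI := Complex.I_ne_zero
    field_simp
  have hcR : ContinuousOn R (Set.Icc a b) := by
    have h1 : ContinuousOn (fun x => g'' x / (lam * g' x ^ 2)) (Set.Icc a b) :=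
      hg''.continuousOn.div (by fun_prop) fun x hx =>
        mul_ne_zero hlam.ne' (pow_ne_zero 2 (hne x hx))
    exact (hcE.continuousOn.mul (Complex.continuous_ofReal.comp_continuousOn h1)).div_const _
  have hiE : IntervalIntegrable E volume a b := hcE.intervalIntegrable a b
  have hiR : IntervalIntegrable R volume a b :=
    ContinuousOn.intervalIntegrable (by rwa [Set.uIcc_of_le hab])
  have hint : ∫ x in a..b, E x = F b - F a + ∫ x in a..b, R x := by
    rw [← intervalIntegral.integral_eq_sub_of_hasDerivAt hdF (hiE.sub hiR),
      intervalIntegral.integral_sub hiE hiR]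
    ring
  have hFle : ∀ x ∈ Set.Icc a b, ‖F x‖ ≤ 1 / (lam * η) := by
    intro x hx
    simp only [hF, hE]
    rw [norm_div, hnorm, norm_mul, Complex.norm_I, one_mul, Complex.norm_real, Real.norm_eq_abs,
      abs_mul, abs_of_pos hlam]
    have := hlow x hx
    gcongr
  have hRle : ∀ x ∈ Set.uIoc a b, ‖R x‖ ≤ M / (lam * η ^ 2) := by
    intro x hx
    rw [Set.uIoc_of_le hab] at hx
    have hx' := Set.Ioc_subset_Icc_self hx
    simp only [hR, hE]
    rw [norm_div, norm_mul, hnorm, Complex.norm_I, one_mul, div_one, Complex.norm_real,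
      Real.norm_eq_abs, abs_div, abs_mul, abs_of_pos hlam, abs_pow]
    have h1 := hlow x hx'
    have h2 := hM x hx'
    have h3 : 0 ≤ M := (abs_nonneg _).trans h2
    gcongr
  rw [hint]
  have h1 := intervalIntegral.norm_integral_le_of_norm_le_const hRle
  rw [abs_of_nonneg (sub_nonneg.2 hab)] at h1
  have h2 := hFle a (Set.left_mem_Icc.2 hab)
  have h3 := hFle b (Set.right_mem_Icc.2 hab)
  calc _ ≤ ‖F b - F a‖ + ‖∫ x in a..b, R x‖ := norm_add_le _ _
    _ ≤ (‖F b‖ + ‖F a‖) + ‖∫ x in a..b, R x‖ := by gcongr; exact norm_sub_le _ _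
    _ ≤ (1 / (lam * η) + 1 / (lam * η)) + M / (lam * η ^ 2) * (b - a) := by gcongr
    _ = _ := by ring

/-- A function whose derivative is at least `η` in absolute value grows at least linearly away
from any minimiser of its absolute value. -/
lemma exists_forall_mul_abs_sub_le_abs {h h' : ℝ → ℝ} {a b η : ℝ} (hab : a ≤ b)
    (hh : ∀ x, HasDerivAt h (h' x) x) (hlow : ∀ x ∈ Set.Icc a b, η ≤ |h' x|) :
    ∃ x₀ ∈ Set.Icc a b, ∀ x ∈ Set.Icc a b, η * |x - x₀| ≤ |h x| := by
  have hc : Continuous h := continuous_iff_continuousAt.2 fun x => (hh x).continuousAt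
  obtain ⟨x₀, hx₀, hmin⟩ := isCompact_Icc.exists_isMinOn (Set.nonempty_Icc.2 hab)
    hc.abs.continuousOn
  refine ⟨x₀, hx₀, fun x hx => ?_⟩
  have hmvt : η * |x - x₀| ≤ |h x - h x₀| := by
    rcases lt_trichotomy x x₀ with hlt | heq | hlt
    · obtain ⟨ξ, hξ, he⟩ := exists_hasDerivAt_eq_slope h h' hlt hc.continuousOn fun y _ => hh y
      have h1 := hlow ξ ⟨hx.1.trans hξ.1.le, hξ.2.le.trans hx₀.2⟩
      have h2 : h x₀ - h x = h' ξ * (x₀ - x) := by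
        rw [he, div_mul_cancel₀]; linarith
      rw [abs_sub_comm (h x), h2, abs_mul, abs_sub_comm x]
      gcongr
    · simp [heq]
    · obtain ⟨ξ, hξ, he⟩ := exists_hasDerivAt_eq_slope h h' hlt hc.continuousOn fun y _ => hh y
      have h1 := hlow ξ ⟨hx₀.1.trans hξ.1.le, hξ.2.le.trans hx.2⟩
      have h2 : h x - h x₀ = h' ξ * (x - x₀) := by
        rw [he, div_mul_cancel₀]; linarith
      rw [h2, abs_mul]
      gcongr
  have hmin' : |h x₀| ≤ |h x| := hmin hx
  by_cases h0 : h x₀ = 0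
  · rwa [h0, sub_zero] at hmvt
  -- a sign change would produce a zero, where the minimum of `|h|` would be attained
  have hsign : 0 ≤ h x * h x₀ := by
    by_contra hneg
    push Not at hneg
    have hzero : (0 : ℝ) ∈ Set.uIcc (h x₀) (h x) := by
      rw [Set.mem_uIcc]
      rcases le_total (h x₀) 0 with hs | hs
      · left; refine ⟨hs, ?_⟩; by_contra hcon; nlinarith
      · right; refine ⟨?_, hs⟩; by_contra hcon; nlinarith
    obtain ⟨y, hy, hy0⟩ := intermediate_value_uIcc hc.continuousOn hzero
    have hyab : y ∈ Set.Icc a b := Set.uIcc_subset_Icc hx₀ hx hy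
    have : |h x₀| ≤ |h y| := hmin hyab
    rw [hy0, abs_zero] at this
    exact h0 (abs_nonpos_iff.1 this)
  refine hmvt.trans ?_
  rcases le_total 0 (h x₀) with hs | hs
  · have hp : 0 < h x₀ := lt_of_le_of_ne hs (Ne.symm h0)
    have hx' : 0 ≤ h x := nonneg_of_mul_nonneg_left hsign hp
    rw [abs_of_nonneg hs, abs_of_nonneg hx'] at hmin'
    rw [abs_of_nonneg hx', abs_of_nonneg (by linarith)]
    linarith
  · have hp : h x₀ < 0 := lt_of_le_of_ne hs h0
    have hx' : h x ≤ 0 := by by_contra hcon; nlinarith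
    rw [abs_of_nonpos hs, abs_of_nonpos hx'] at hmin'
    rw [abs_of_nonpos hx', abs_of_nonpos (by linarith)]
    linarith

/-- Van der Corput's estimate with unspecified constants, by induction on the order: the interval on
which the derivative of the previous order is small is excised and estimated trivially. The sequence
`D` lists the phase and its successive derivatives; the constants depend only on the order `r + 1`
of the derivative that is bounded below, on a bound for the length of the interval, and on a bound
for the second derivative. -/
theorem exists_norm_integral_cexp_le_rpow (len M : ℝ) (hlen : 0 ≤ len) (hM : 0 ≤ M) (r : ℕ) :
    ∃ K δ : ℝ, 0 < K ∧ 0 < δ ∧ δ ≤ 1 ∧ ∀ D : ℕ → ℝ → ℝ,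
      (∀ j x, HasDerivAt (D j) (D (j + 1) x) x) → ∀ a b : ℝ, a ≤ b → b - a ≤ len →
      (∀ x ∈ Set.Icc a b, |D 2 x| ≤ M) → ∀ η : ℝ, 0 < η → η ≤ 1 →
      (∀ x ∈ Set.Icc a b, η ≤ |D (r + 1) x|) → ∀ lam : ℝ, 0 < lam →
      ‖∫ x in a..b, Complex.exp (Complex.I * (lam * D 0 x : ℝ))‖
        ≤ K * (η ^ 2 * lam) ^ (-δ) := by
  induction r with
  | zero =>
    refine ⟨2 + M * len, 1, by positivity, one_pos, le_rfl, ?_⟩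
    intro D hD a b hab hl h2 η hη hη1 hlow lam hlam
    have hc : Continuous (D 2) := continuous_iff_continuousAt.2 fun x => (hD 2 x).continuousAt
    refine (norm_integral_cexp_le_of_abs_deriv_ge hab (hD 0) (hD 1) hc hη hlow h2 hlam).trans ?_
    rw [Real.rpow_neg_one]
    have h3 : 2 / (lam * η) ≤ 2 / (η ^ 2 * lam) := by
      apply div_le_div_of_nonneg_left (by norm_num) (by positivity)
      nlinarith [mul_pos hlam hη]
    have h4 : M / (lam * η ^ 2) * (b - a) ≤ M / (lam * η ^ 2) * len := by gcongr
    calc _ ≤ 2 / (η ^ 2 * lam) + M / (lam * η ^ 2) * len := add_le_add h3 h4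
      _ = _ := by field_simp
  | succ r ih =>
    obtain ⟨K, δ, hK, hδ, hδ1, ih⟩ := ih
    refine ⟨len + 2 + 2 * K, δ / (1 + 2 * δ), by positivity, by positivity, ?_, ?_⟩
    · rw [div_le_one (by positivity)]; linarith
    intro D hD a b hab hl h2 η hη hη1 hlow lam hlam
    have hc : Continuous (D 0) := continuous_iff_continuousAt.2 fun x => (hD 0 x).continuousAt
    set E : ℝ → ℂ := fun x => Complex.exp (Complex.I * (lam * D 0 x : ℝ)) with hE
    have hEc : Continuous E := by rw [hE]; fun_prop
    have hnorm : ∀ t, ‖E t‖ ≤ 1 := fun t => by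
      rw [hE]; simp only; rw [mul_comm]; exact (Complex.norm_exp_ofReal_mul_I _).le
    have htriv : ∀ u v : ℝ, u ≤ v → ‖∫ x in u..v, E x‖ ≤ v - u := fun u v huv => by
      have := intervalIntegral.norm_integral_le_of_norm_le_const (a := u) (b := v) (C := 1)
        (f := E) fun x _ => hnorm x
      rwa [one_mul, abs_of_nonneg (sub_nonneg.2 huv)] at this
    set lam' := η ^ 2 * lam with hL
    have hLpos : 0 < lam' := by positivity
    -- the radius of the excised interval, chosen to balance the two contributions
    set s := lam' ^ (-(δ / (1 + 2 * δ))) with hs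
    have hspos : 0 < s := Real.rpow_pos_of_pos hLpos _
    rcases lt_or_ge lam' 1 with hlt | hge
    · have : 1 ≤ s := Real.one_le_rpow_of_pos_of_le_one_of_nonpos hLpos hlt.le
        (neg_nonpos.2 (by positivity))
      calc ‖∫ x in a..b, E x‖ ≤ b - a := htriv a b hab
        _ ≤ (len + 2 + 2 * K) * 1 := by linarith
        _ ≤ _ := by gcongr
    have hs1 : s ≤ 1 := Real.rpow_le_one_of_one_le_of_nonpos hge (neg_nonpos.2 (by positivity))
    have hbal : ((η * s) ^ 2 * lam) ^ (-δ) = s := by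
      have e1 : (η * s) ^ 2 * lam = lam' * s ^ (2 : ℝ) := by
        rw [hL, Real.rpow_two]; ring
      rw [e1, Real.mul_rpow hLpos.le (by positivity), hs, ← Real.rpow_mul hLpos.le,
        ← Real.rpow_mul hLpos.le, ← Real.rpow_add hLpos]
      congr 1
      field_simp
      ring
    obtain ⟨x₀, hx₀, hx₀le⟩ := exists_forall_mul_abs_sub_le_abs hab (hD (r + 1)) hlow
    have hfar : ∀ u v : ℝ, a ≤ u → u ≤ v → v ≤ b → (∀ x ∈ Set.Icc u v, s ≤ |x - x₀|) →
        ‖∫ x in u..v, E x‖ ≤ K * s := by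
      intro u v hau huv hvb hfar
      have hsub : Set.Icc u v ⊆ Set.Icc a b := Set.Icc_subset_Icc hau hvb
      have := ih D hD u v huv (by linarith) (fun x hx => h2 x (hsub hx)) (η * s) (by positivity)
        (by nlinarith) (fun x hx => le_trans (by have := hfar x hx; gcongr) (hx₀le x (hsub hx)))
        lam hlam
      rwa [hbal] at this
    have hi : ∀ u v : ℝ, IntervalIntegrable E volume u v := fun u v => hEc.intervalIntegrable u v
    have hI1 : ‖∫ x in a..(max a (x₀ - s)), E x‖ ≤ K * s := by
      rcases le_total (x₀ - s) a with h | h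
      · rw [max_eq_left h, intervalIntegral.integral_same, norm_zero]; positivity
      · rw [max_eq_right h]
        refine hfar _ _ le_rfl h (by linarith [hx₀.2]) fun x hx => ?_
        rw [abs_sub_comm]
        exact le_trans (by linarith [hx.2]) (le_abs_self _)
    have hI3 : ‖∫ x in (min b (x₀ + s))..b, E x‖ ≤ K * s := by
      rcases le_total (x₀ + s) b with h | h
      · rw [min_eq_right h]
        refine hfar _ _ (by linarith [hx₀.1]) h le_rfl fun x hx => ?_
        exact le_trans (by linarith [hx.1]) (le_abs_self _)
      · rw [min_eq_left h, intervalIntegral.integral_same, norm_zero]; positivity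
    have hI2 : ‖∫ x in (max a (x₀ - s))..(min b (x₀ + s)), E x‖ ≤ 2 * s := by
      refine (htriv _ _ ?_).trans ?_
      · exact (max_le hx₀.1 (by linarith)).trans (le_min hx₀.2 (by linarith))
      · have := le_max_right a (x₀ - s)
        have := min_le_right b (x₀ + s)
        linarith
    rw [← intervalIntegral.integral_add_adjacent_intervals (hi a (min b (x₀ + s))) (hi _ b),
      ← intervalIntegral.integral_add_adjacent_intervals (hi a (max a (x₀ - s))) (hi _ _)]
    calc _ ≤ K * s + 2 * s + K * s := (norm_add₃_le).trans (by gcongr)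
      _ ≤ (len + 2 + 2 * K) * s := by nlinarith

/-! ### Uniform oscillatory estimates for linear combinations of analytic functions -/

/-- The combinations `∑ cᵢ fᵢ⁽ʲ⁾` form a sequence of successive derivatives. -/
lemma hasDerivAt_sum_mul_iteratedDeriv {k : ℕ} {f : Fin k → ℝ → ℝ}
    (hf : ∀ i, AnalyticOnNhd ℝ (f i) Set.univ) (c : Fin k → ℝ) (j : ℕ) (x : ℝ) :
    HasDerivAt (fun y => ∑ i, c i * iteratedDeriv j (f i) y)
      (∑ i, c i * iteratedDeriv (j + 1) (f i) x) x := by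
  refine HasDerivAt.fun_sum fun i _ => HasDerivAt.const_mul _ ?_
  rw [iteratedDeriv_succ]
  have h : ContDiff ℝ ⊤ (f i) := (hf i).contDiff
  exact ((h.differentiable_iteratedDeriv j (by simp)) x).hasDerivAt

/-- If all derivatives of positive order vanished at a point, the identity theorem would make the
combination constant, contradicting independence from the constant function. -/
lemma exists_iteratedDeriv_sum_ne_zero {k : ℕ} {f : Fin k → ℝ → ℝ}
    (hf : ∀ i, AnalyticOnNhd ℝ (f i) Set.univ)
    (hind : LinearIndependent ℝ (Fin.cons (fun _ => 1) f : Fin (k + 1) → ℝ → ℝ))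
    {c : Fin k → ℝ} (hc : c ≠ 0) (x₀ : ℝ) :
    ∃ r : ℕ, ∑ i, c i * iteratedDeriv (r + 1) (f i) x₀ ≠ 0 := by
  by_contra! hcon
  set D : ℕ → ℝ → ℝ := fun j y => ∑ i, c i * iteratedDeriv j (f i) y with hD
  have hder := hasDerivAt_sum_mul_iteratedDeriv hf c
  have han : AnalyticOnNhd ℝ (D 1) Set.univ := by
    refine Finset.analyticOnNhd_fun_sum _ fun i _ => analyticOnNhd_const.mul ?_
    rw [iteratedDeriv_one]
    exact (hf i).deriv
  have hiter : ∀ j, iteratedDeriv j (D 1) = D (j + 1) := by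
    intro j
    induction j with
    | zero => simp
    | succ j ih => rw [iteratedDeriv_succ, ih]; exact funext fun x => (hder (j + 1) x).deriv
  have htop : analyticOrderAt (D 1) x₀ = ⊤ := by
    refine ENat.eq_top_iff_forall_ge.2 fun n => ?_
    rw [natCast_le_analyticOrderAt_iff_iteratedDeriv_eq_zero (han x₀ (Set.mem_univ _))]
    intro i _
    rw [hiter]
    exact hcon i
  have hzero : D 1 = 0 := han.eq_of_eventuallyEq analyticOnNhd_const
    (analyticOrderAt_eq_top.1 htop)
  have hconst : ∀ x, D 0 x = D 0 x₀ := fun x =>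
    is_const_of_deriv_eq_zero (fun y => (hder 0 y).differentiableAt)
      (fun y => by rw [(hder 0 y).deriv]; exact congrFun hzero y) x x₀
  rw [Fintype.linearIndependent_iff] at hind
  have := hind (Fin.cons (-D 0 x₀) c) (by
    ext x
    have := hconst x
    simp only [hD, iteratedDeriv_zero] at this ⊢
    simp [Fin.sum_univ_succ, this])
  exact hc (funext fun i => by simpa using this i.succ)

/-- Near each point, the oscillatory integrals with phase `lam • ∑ cᵢ fᵢ` decay at a power rate,
uniformly for `c` in the unit sphere. The sphere is covered by finitely many neighbourhoods
on which a derivative of one fixed order is bounded below; the smallest of the corresponding `ρ`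
and `δ` serve for all of them. -/
theorem exists_norm_integral_cexp_sum_le {k : ℕ} {f : Fin k → ℝ → ℝ}
    (hf : ∀ i, AnalyticOnNhd ℝ (f i) Set.univ)
    (hind : LinearIndependent ℝ (Fin.cons (fun _ => 1) f : Fin (k + 1) → ℝ → ℝ)) (x₀ : ℝ) :
    ∃ ρ δ K : ℝ, 0 < ρ ∧ 0 < δ ∧ δ ≤ 1 ∧ 0 < K ∧ ∀ c : Fin k → ℝ, ‖c‖ = 1 →
      ∀ a b, x₀ - ρ ≤ a → a ≤ b → b ≤ x₀ + ρ → ∀ lam : ℝ, 1 ≤ lam →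
        ‖∫ x in a..b, Complex.exp (Complex.I * (lam * ∑ i, c i * f i x : ℝ))‖
          ≤ K * lam ^ (-δ) := by
  suffices h : ∃ ρ δ K : ℝ, 0 < ρ ∧ 0 < δ ∧ δ ≤ 1 ∧ 0 < K ∧
      ∀ c ∈ Metric.sphere (0 : Fin k → ℝ) 1,
      ∀ a b, x₀ - ρ ≤ a → a ≤ b → b ≤ x₀ + ρ → ∀ lam : ℝ, 1 ≤ lam →
        ‖∫ x in a..b, Complex.exp (Complex.I * (lam * ∑ i, c i * f i x : ℝ))‖
          ≤ K * lam ^ (-δ) by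
    simpa only [mem_sphere_zero_iff_norm] using h
  refine (isCompact_sphere (0 : Fin k → ℝ) 1).induction_on
    (p := fun S => ∃ ρ δ K : ℝ, 0 < ρ ∧ 0 < δ ∧ δ ≤ 1 ∧ 0 < K ∧ ∀ c ∈ S,
      ∀ a b, x₀ - ρ ≤ a → a ≤ b → b ≤ x₀ + ρ → ∀ lam : ℝ, 1 ≤ lam →
        ‖∫ x in a..b, Complex.exp (Complex.I * (lam * ∑ i, c i * f i x : ℝ))‖
          ≤ K * lam ^ (-δ)) ?_ ?_ ?_ ?_
  · exact ⟨1, 1, 1, one_pos, one_pos, le_rfl, one_pos, fun c hc => absurd hc (Set.notMem_empty c)⟩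
  · rintro s t hst ⟨ρ, δ, K, hρ, hδ, hδ1, hK, h⟩
    exact ⟨ρ, δ, K, hρ, hδ, hδ1, hK, fun c hc => h c (hst hc)⟩
  · rintro s t ⟨ρ, δ, K, hρ, hδ, hδ1, hK, h⟩ ⟨ρ', δ', K', hρ', hδ', hδ1', hK', h'⟩
    refine ⟨min ρ ρ', min δ δ', max K K', lt_min hρ hρ', lt_min hδ hδ',
      (min_le_left _ _).trans hδ1, lt_max_of_lt_left hK, ?_⟩
    have h1 := min_le_left ρ ρ'
    have h2 := min_le_right ρ ρ'
    rintro c (hc | hc) a b ha hab hb lam hlam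
    · refine (h c hc a b (by linarith) hab (by linarith) lam hlam).trans ?_
      gcongr
      · exact le_max_left _ _
      · exact min_le_left _ _
    · refine (h' c hc a b (by linarith) hab (by linarith) lam hlam).trans ?_
      gcongr
      · exact le_max_right _ _
      · exact min_le_right _ _
  intro c₀ hc₀
  have hc₀' : c₀ ≠ 0 := by
    rintro rfl
    simp at hc₀
  obtain ⟨r, hr⟩ := exists_iteratedDeriv_sum_ne_zero hf hind hc₀' x₀
  have hcont : ∀ j, Continuous fun p : (Fin k → ℝ) × ℝ =>
      ∑ i, p.1 i * iteratedDeriv j (f i) p.2 := by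
    intro j
    refine continuous_finsetSum _ fun i _ => ?_
    have h : ContDiff ℝ ⊤ (f i) := (hf i).contDiff
    have := h.continuous_iteratedDeriv j (by simp)
    fun_prop
  set y := |∑ i, c₀ i * iteratedDeriv (r + 1) (f i) x₀| with hy
  have hypos : 0 < y := abs_pos.2 hr
  set η := min 1 (y / 2) with hη
  have hηpos : 0 < η := lt_min one_pos (by positivity)
  set M := |∑ i, c₀ i * iteratedDeriv 2 (f i) x₀| + 1 with hM
  have ev1 : ∀ᶠ p : (Fin k → ℝ) × ℝ in 𝓝 (c₀, x₀),
      η < |∑ i, p.1 i * iteratedDeriv (r + 1) (f i) p.2| :=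
    (hcont (r + 1)).abs.continuousAt.eventually_const_lt
      ((min_le_right _ _).trans_lt (half_lt_self hypos))
  have ev2 : ∀ᶠ p : (Fin k → ℝ) × ℝ in 𝓝 (c₀, x₀),
      |∑ i, p.1 i * iteratedDeriv 2 (f i) p.2| < M :=
    (hcont 2).abs.continuousAt.eventually_lt_const (lt_add_one _)
  obtain ⟨U, hU, V, hV, hUV⟩ := mem_nhds_prod_iff.1 (ev1.and ev2)
  obtain ⟨ρ, hρ, hρV⟩ := Metric.nhds_basis_closedBall.mem_iff.1 hV
  obtain ⟨K, δ, hK, hδ, hδ1, hvdc⟩ :=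
    exists_norm_integral_cexp_le_rpow (2 * ρ) M (by positivity) (by positivity) r
  refine ⟨U, mem_nhdsWithin_of_mem_nhds hU, ρ, δ, K * (η ^ 2) ^ (-δ), hρ, hδ, hδ1,
    by positivity, ?_⟩
  intro c hc a b ha hab hb lam hlam
  have hmem : ∀ x ∈ Set.Icc a b, (c, x) ∈ U ×ˢ V := fun x hx => ⟨hc, hρV (by
    rw [Real.closedBall_eq_Icc]
    exact ⟨ha.trans hx.1, hx.2.trans hb⟩)⟩
  have := hvdc (fun j x => ∑ i, c i * iteratedDeriv j (f i) x)
    (hasDerivAt_sum_mul_iteratedDeriv hf c) a b hab (by linarith)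
    (fun x hx => (hUV (hmem x hx)).2.le) η hηpos (min_le_left _ _)
    (fun x hx => (hUV (hmem x hx)).1.le) lam (by linarith)
  simp only [iteratedDeriv_zero] at this
  refine this.trans_eq ?_
  rw [Real.mul_rpow (by positivity) (by linarith)]
  ring

lemma truncInvPow_eq_one {δ t : ℝ} (hδ : 0 < δ) (ht : 0 ≤ t) (ht1 : t ≤ 1) :
    truncInvPow δ t = 1 := by
  unfold truncInvPow
  split_ifs with h
  · rfl
  · exact min_eq_right (Real.one_le_rpow_of_pos_of_le_one_of_nonpos (lt_of_le_of_ne ht (Ne.symm h))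
      ht1 (by linarith))

lemma truncInvPow_eq_rpow {δ t : ℝ} (hδ : 0 < δ) (ht : 1 ≤ t) :
    truncInvPow δ t = t ^ (-δ) := by
  unfold truncInvPow
  rw [if_neg (by linarith)]
  exact min_eq_left (Real.rpow_le_one_of_one_le_of_nonpos ht (by linarith))

/-- The oscillatory estimate in the form in which it meets the scattering hypothesis. -/
theorem exists_norm_integral_cexp_sum_le_truncInvPow {k : ℕ} {f : Fin k → ℝ → ℝ}
    (hf : ∀ i, AnalyticOnNhd ℝ (f i) Set.univ)
    (hind : LinearIndependent ℝ (Fin.cons (fun _ => 1) f : Fin (k + 1) → ℝ → ℝ)) (x₀ : ℝ) :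
    ∃ ρ δ K : ℝ, 0 < ρ ∧ 0 < δ ∧ δ ≤ 1 ∧ 0 < K ∧ ∀ (c : Fin k → ℝ) (t : ℝ), 0 ≤ t → t ≤ ‖c‖ →
      ‖∫ x in (x₀ - ρ)..(x₀ + ρ), Complex.exp (Complex.I * (∑ i, c i * f i x : ℝ))‖
        ≤ K * truncInvPow δ t := by
  obtain ⟨ρ, δ, K, hρ, hδ, hδ1, hK, h⟩ := exists_norm_integral_cexp_sum_le hf hind x₀
  refine ⟨ρ, δ, max K (2 * ρ), hρ, hδ, hδ1, lt_max_of_lt_left hK, fun c t ht htc => ?_⟩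
  rcases le_total t 1 with ht1 | ht1
  · rw [truncInvPow_eq_one hδ ht ht1, mul_one]
    refine le_trans ?_ (le_max_right _ _)
    have := intervalIntegral.norm_integral_le_of_norm_le_const (a := x₀ - ρ) (b := x₀ + ρ) (C := 1)
      (f := fun x => Complex.exp (Complex.I * (∑ i, c i * f i x : ℝ))) fun x _ => by
        rw [mul_comm]; exact (Complex.norm_exp_ofReal_mul_I _).le
    rw [one_mul, abs_of_nonneg (by linarith)] at this
    linarith
  · rw [truncInvPow_eq_rpow hδ ht1]
    have hc : 0 < ‖c‖ := by linarith
    have := h (‖c‖⁻¹ • c) (by rw [norm_smul, norm_inv, norm_norm, inv_mul_cancel₀ hc.ne'])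
      (x₀ - ρ) (x₀ + ρ) le_rfl (by linarith) le_rfl ‖c‖ (ht1.trans htc)
    have e : ∀ x, ‖c‖ * ∑ i, (‖c‖⁻¹ • c) i * f i x = ∑ i, c i * f i x := by
      intro x
      rw [Finset.mul_sum]
      refine Finset.sum_congr rfl fun i _ => ?_
      simp only [Pi.smul_apply, smul_eq_mul]
      field_simp
    simp only [e] at this
    refine this.trans ?_
    have h1 : ‖c‖ ^ (-δ) ≤ t ^ (-δ) :=
      Real.rpow_le_rpow_of_nonpos (by linarith) htc (by linarith)
    gcongr
    exact le_max_left _ _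

/-! ### Averages along a subexponential subsequence -/

lemma tendsto_add_one_rpow_sub_rpow {β : ℝ} (hβ : 0 < β) (hβ1 : β < 1) :
    Tendsto (fun n : ℕ => ((n : ℝ) + 1) ^ β - (n : ℝ) ^ β) atTop (𝓝 0) := by
  have hlim : Tendsto (fun n : ℕ => β * (n : ℝ) ^ (-(1 - β))) atTop (𝓝 0) := by
    simpa using ((tendsto_rpow_neg_atTop (by linarith : 0 < 1 - β)).comp
      tendsto_natCast_atTop_atTop).const_mul β
  refine squeeze_zero' (Eventually.of_forall fun n => ?_) ?_ hlim
  · exact sub_nonneg.2 (Real.rpow_le_rpow n.cast_nonneg (by linarith) hβ.le)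
  · filter_upwards [eventually_gt_atTop 0] with n hn
    have hn' : (0 : ℝ) < n := by exact_mod_cast hn
    have e1 : ((n : ℝ) + 1) ^ β = (n : ℝ) ^ β * (1 + 1 / n) ^ β := by
      rw [← Real.mul_rpow hn'.le (by positivity)]
      congr 1
      field_simp
    have e2 : (1 + 1 / (n : ℝ)) ^ β ≤ 1 + β * (1 / n) :=
      rpow_one_add_le_one_add_mul_self (by
        have : (0 : ℝ) ≤ 1 / n := by positivity
        linarith) hβ.le hβ1.le
    have e3 : (n : ℝ) ^ (-(1 - β)) = (n : ℝ) ^ β * (1 / n) := by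
      rw [show -(1 - β) = β - 1 by ring, Real.rpow_sub_one hn'.ne']
      ring
    rw [e1, e3]
    have : (n : ℝ) ^ β * (1 + 1 / n) ^ β ≤ (n : ℝ) ^ β * (1 + β * (1 / n)) := by gcongr
    linarith

lemma tendsto_exp_rpow_atTop {β : ℝ} (hβ : 0 < β) :
    Tendsto (fun n : ℕ => Real.exp ((n : ℝ) ^ β)) atTop atTop :=
  Real.tendsto_exp_atTop.comp ((tendsto_rpow_atTop hβ).comp tendsto_natCast_atTop_atTop)

lemma tendsto_ceil_exp_rpow_atTop {β : ℝ} (hβ : 0 < β) :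
    Tendsto (fun n : ℕ => ⌈Real.exp ((n : ℝ) ^ β)⌉₊) atTop atTop :=
  tendsto_nat_ceil_atTop.comp (tendsto_exp_rpow_atTop hβ)

/-- The subsequence `⌈exp (n ^ β)⌉` with `β < 1` grows subexponentially. -/
lemma eventually_ceil_exp_rpow_succ_le {β : ℝ} (hβ : 0 < β) (hβ1 : β < 1) {q : ℝ} (hq : 1 < q) :
    ∀ᶠ n : ℕ in atTop, (⌈Real.exp (((n + 1 : ℕ) : ℝ) ^ β)⌉₊ : ℝ)
      ≤ q * ⌈Real.exp ((n : ℝ) ^ β)⌉₊ := by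
  have h1 : Tendsto (fun n : ℕ => Real.exp (((n : ℝ) + 1) ^ β - (n : ℝ) ^ β)
      + 1 / Real.exp ((n : ℝ) ^ β)) atTop (𝓝 (Real.exp 0 + 0)) :=
    ((Real.continuous_exp.tendsto 0).comp (tendsto_add_one_rpow_sub_rpow hβ hβ1)).add
      ((tendsto_exp_rpow_atTop hβ).const_div_atTop 1)
  rw [Real.exp_zero, add_zero] at h1
  filter_upwards [h1.eventually_le_const hq] with n hn
  have hp := Real.exp_pos ((n : ℝ) ^ β)
  calc (⌈Real.exp (((n + 1 : ℕ) : ℝ) ^ β)⌉₊ : ℝ)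
      ≤ Real.exp (((n : ℝ) + 1) ^ β) + 1 := by
        push_cast
        exact (Nat.ceil_lt_add_one (Real.exp_pos _).le).le
    _ = (Real.exp (((n : ℝ) + 1) ^ β - (n : ℝ) ^ β) + 1 / Real.exp ((n : ℝ) ^ β))
          * Real.exp ((n : ℝ) ^ β) := by
        rw [Real.exp_sub]
        field_simp
    _ ≤ q * Real.exp ((n : ℝ) ^ β) := by gcongr
    _ ≤ q * ⌈Real.exp ((n : ℝ) ^ β)⌉₊ := by
        gcongr
        exact Nat.le_ceil _

/-- Averages of a bounded sequence that vanish along a subexponential subsequence vanish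
altogether. -/
lemma tendsto_average_of_subseq_real {β : ℝ} (hβ : 0 < β) (hβ1 : β < 1) {v : ℕ → ℝ}
    (hv : ∀ n, |v n| ≤ 1)
    (hsub : Tendsto (fun j : ℕ => (∑ n ∈ Finset.Icc 1 ⌈Real.exp ((j : ℝ) ^ β)⌉₊, v n)
      / (⌈Real.exp ((j : ℝ) ^ β)⌉₊ : ℝ)) atTop (𝓝 0)) :
    Tendsto (fun N : ℕ => (∑ n ∈ Finset.Icc 1 N, v n) / (N : ℝ)) atTop (𝓝 0) := by
  have hdiv : ∀ N : ℕ, 0 < N → (∑ n ∈ Finset.Icc 1 N, (1 + v n)) / (N : ℝ)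
      = 1 + (∑ n ∈ Finset.Icc 1 N, v n) / (N : ℝ) := by
    intro N hN
    have : (N : ℝ) ≠ 0 := by exact_mod_cast hN.ne'
    rw [Finset.sum_add_distrib]
    simp only [Finset.sum_const, Nat.card_Icc, add_tsub_cancel_right, nsmul_eq_mul, mul_one]
    field_simp
  -- adding `1` to each term makes the partial sums monotone
  have key := tendsto_div_of_monotone_of_exists_subseq_tendsto_div
    (fun N => ∑ n ∈ Finset.Icc 1 N, (1 + v n)) 1
    (fun a b hab => Finset.sum_le_sum_of_subset_of_nonneg (Finset.Icc_subset_Icc le_rfl hab)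
      fun n _ _ => by linarith [neg_le_of_abs_le (hv n)])
    (fun q hq => ⟨fun j => ⌈Real.exp ((j : ℝ) ^ β)⌉₊, eventually_ceil_exp_rpow_succ_le hβ hβ1 hq,
      tendsto_ceil_exp_rpow_atTop hβ, by
        have := hsub.const_add 1
        rw [add_zero] at this
        exact this.congr fun j => (hdiv _ (Nat.ceil_pos.2 (Real.exp_pos _))).symm⟩)
  have := key.sub_const 1
  rw [sub_self] at this
  refine this.congr' ?_
  filter_upwards [eventually_gt_atTop 0] with N hN
  rw [hdiv N hN]
  ring

lemma tendsto_average_of_subseq {β : ℝ} (hβ : 0 < β) (hβ1 : β < 1) {v : ℕ → ℂ}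
    (hv : ∀ n, ‖v n‖ ≤ 1)
    (hsub : Tendsto (fun j : ℕ => (∑ n ∈ Finset.Icc 1 ⌈Real.exp ((j : ℝ) ^ β)⌉₊, v n)
      / ((⌈Real.exp ((j : ℝ) ^ β)⌉₊ : ℝ) : ℂ)) atTop (𝓝 0)) :
    Tendsto (fun N : ℕ => (∑ n ∈ Finset.Icc 1 N, v n) / ((N : ℝ) : ℂ)) atTop (𝓝 0) := by
  have hre := tendsto_average_of_subseq_real hβ hβ1 (v := fun n => (v n).re)
    (fun n => (Complex.abs_re_le_norm _).trans (hv n))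
    (by
      refine ((Complex.continuous_re.tendsto 0).comp hsub).congr fun j => ?_
      simp only [Function.comp, Complex.div_ofReal_re, Complex.re_sum])
  have him := tendsto_average_of_subseq_real hβ hβ1 (v := fun n => (v n).im)
    (fun n => (Complex.abs_im_le_norm _).trans (hv n))
    (by
      refine ((Complex.continuous_im.tendsto 0).comp hsub).congr fun j => ?_
      simp only [Function.comp, Complex.div_ofReal_im, Complex.im_sum])
  have h := ((Complex.continuous_ofReal.tendsto 0).comp hre).add
    (((Complex.continuous_ofReal.tendsto 0).comp him).mul_const Complex.I)
  simp only [Complex.ofReal_zero, zero_mul, add_zero] at h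
  refine h.congr fun N => ?_
  rw [← Complex.re_add_im ((∑ n ∈ Finset.Icc 1 N, v n) / ((N : ℝ) : ℂ))]
  simp only [Function.comp, Complex.div_ofReal_re, Complex.re_sum, Complex.div_ofReal_im,
    Complex.im_sum]

/-- The Davenport–Erdős–LeVeque principle: a second moment bound that saves a power of the
logarithm larger than one forces the averages to vanish almost everywhere. -/
theorem ae_tendsto_average_of_integral_norm_sq_le {α : Type*} [MeasurableSpace α] {μ : Measure α}
    [IsFiniteMeasure μ] {u : ℕ → α → ℂ} (hu : ∀ n, Measurable (u n)) (hu1 : ∀ n x, ‖u n x‖ ≤ 1)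
    {C ε : ℝ} (hε : 0 < ε)
    (hmom : ∀ᶠ N : ℕ in atTop, ∫ x, ‖(∑ n ∈ Finset.Icc 1 N, u n x) / ((N : ℝ) : ℂ)‖ ^ 2 ∂μ
      ≤ C * (1 / Real.log N ^ (1 + ε))) :
    ∀ᵐ x ∂μ, Tendsto (fun N : ℕ => (∑ n ∈ Finset.Icc 1 N, u n x) / ((N : ℝ) : ℂ))
      atTop (𝓝 0) := by
  -- the exponent satisfies both `β < 1` and `β * (1 + ε) > 1`
  set β : ℝ := 2 / (2 + ε) with hβdef
  have hβ : 0 < β := by positivity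
  have hβ1 : β < 1 := by rw [hβdef, div_lt_one (by positivity)]; linarith
  have hβε : 1 < β * (1 + ε) := by
    rw [hβdef, div_mul_eq_mul_div, one_lt_div (by positivity)]; linarith
  set S : ℕ → α → ℂ := fun N x => (∑ n ∈ Finset.Icc 1 N, u n x) / ((N : ℝ) : ℂ) with hS
  have hSm : ∀ N, Measurable (S N) := fun N =>
    (Finset.measurable_fun_sum _ fun n _ => hu n).div_const _
  have hS1 : ∀ N x, ‖S N x‖ ≤ 1 := by
    intro N x
    rw [hS]
    simp only [norm_div, Complex.norm_real, Real.norm_natCast]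
    refine div_le_one_of_le₀ ?_ N.cast_nonneg
    refine (norm_sum_le _ _).trans ((Finset.sum_le_sum fun n _ => hu1 n x).trans ?_)
    simp
  set c : ℕ → ℕ := fun j => ⌈Real.exp ((j : ℝ) ^ β)⌉₊ with hc
  set G : ℕ → α → ℝ := fun j x => ‖S (c j) x‖ ^ 2 with hG
  have hGm : ∀ j, Measurable (G j) := fun j => ((hSm _).norm).pow_const 2
  have hG0 : ∀ j x, 0 ≤ G j x := fun j x => by positivity
  have hGi : ∀ j, Integrable (G j) μ := fun j =>
    Integrable.of_bound (hGm j).aestronglyMeasurable 1 (Eventually.of_forall fun x => by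
      rw [Real.norm_of_nonneg (hG0 j x)]
      exact pow_le_one₀ (norm_nonneg _) (hS1 _ _))
  have hsum : Summable fun j => ∫ x, G j x ∂μ := by
    have hs : Summable fun j : ℕ => |C| * (1 / (j : ℝ) ^ (β * (1 + ε))) :=
      (Real.summable_one_div_nat_rpow.2 hβε).mul_left _
    refine hs.of_norm_bounded_eventually_nat ?_
    filter_upwards [(tendsto_ceil_exp_rpow_atTop hβ).eventually hmom, eventually_gt_atTop 0]
      with j hj hj0
    have hj0' : (0 : ℝ) < j := by exact_mod_cast hj0
    rw [Real.norm_of_nonneg (integral_nonneg (hG0 j))]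
    refine hj.trans ?_
    have hlog : (j : ℝ) ^ β ≤ Real.log (⌈Real.exp ((j : ℝ) ^ β)⌉₊ : ℝ) := by
      rw [Real.le_log_iff_exp_le (by exact_mod_cast Nat.ceil_pos.2 (Real.exp_pos _))]
      exact Nat.le_ceil _
    have hpos : 0 < (j : ℝ) ^ β := by positivity
    rw [Real.rpow_mul hj0'.le]
    have := hpos.le.trans hlog
    gcongr
    exact le_abs_self C
  have hae : ∀ᵐ x ∂μ, Tendsto (fun j => G j x) atTop (𝓝 0) := by
    have hlt : ∫⁻ x, ∑' j, ENNReal.ofReal (G j x) ∂μ ≠ ⊤ := by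
      rw [lintegral_tsum fun j => (hGm j).ennreal_ofReal.aemeasurable]
      have e : ∀ j, ∫⁻ x, ENNReal.ofReal (G j x) ∂μ = ENNReal.ofReal (∫ x, G j x ∂μ) := fun j =>
        (ofReal_integral_eq_lintegral_ofReal (hGi j) (Eventually.of_forall (hG0 j))).symm
      simp only [e]
      rw [← ENNReal.ofReal_tsum_of_nonneg (fun j => integral_nonneg (hG0 j)) hsum]
      exact ENNReal.ofReal_ne_top
    have hm : AEMeasurable (fun x => ∑' j, ENNReal.ofReal (G j x)) μ :=
      (Measurable.tsum fun j => (hGm j).ennreal_ofReal).aemeasurable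
    filter_upwards [ae_lt_top' hm hlt] with x hx
    have := ENNReal.tendsto_atTop_zero_of_tsum_ne_top hx.ne
    have h2 := (ENNReal.tendsto_toReal ENNReal.zero_ne_top).comp this
    refine h2.congr fun j => ?_
    simp [ENNReal.toReal_ofReal (hG0 j x)]
  filter_upwards [hae] with x hx
  refine tendsto_average_of_subseq hβ hβ1 (fun n => hu1 n x) ?_
  rw [tendsto_zero_iff_norm_tendsto_zero]
  have := hx.sqrt
  rw [Real.sqrt_zero] at this
  exact this.congr fun j => Real.sqrt_sq (norm_nonneg _)

/-! ### Weyl's criterion on the torus -/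

/-- The reduction modulo one of a point of `ℝᵏ`. -/
def toUnitTorus {k : ℕ} (x : Fin k → ℝ) : UnitAddTorus (Fin k) := fun i => (x i : UnitAddCircle)

lemma continuous_toUnitTorus {k : ℕ} : Continuous (toUnitTorus (k := k)) :=
  continuous_pi fun i => (AddCircle.continuous_mk' (1 : ℝ)).comp (continuous_apply i)

/-- Lebesgue measure on the open unit cube. Its image in the torus is the limiting distribution;
the open cube is convenient because there the reduction modulo one has a continuous inverse. -/
noncomputable def unitCubeMeasure (k : ℕ) : Measure (Fin k → ℝ) :=
  volume.restrict (Set.univ.pi fun _ => Set.Ioo 0 1)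

lemma unitCubeMeasure_eq_pi (k : ℕ) :
    unitCubeMeasure k = Measure.pi fun _ => volume.restrict (Set.Ioo (0 : ℝ) 1) :=
  Measure.restrict_pi_pi _ _

instance isProbabilityMeasure_unitCubeMeasure (k : ℕ) :
    IsProbabilityMeasure (unitCubeMeasure k) :=
  ⟨by simp [unitCubeMeasure, Real.volume_pi_Ioo]⟩

lemma unitCubeMeasure_apply_of_subset {k : ℕ} {B : Set (Fin k → ℝ)} (hB : B ⊆ Set.Icc 0 1) :
    unitCubeMeasure k B = volume B := by
  have h : (Set.univ.pi fun _ : Fin k => Set.Ioo (0 : ℝ) 1) =ᵐ[volume] Set.Icc 0 1 :=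
    Measure.univ_pi_Ioo_ae_eq_Icc (f := (0 : Fin k → ℝ)) (g := 1)
  rw [unitCubeMeasure, Measure.restrict_congr_set h, Measure.restrict_apply' measurableSet_Icc,
    Set.inter_eq_left.2 hB]

lemma mFourier_toUnitTorus {k : ℕ} (h : Fin k → ℤ) (x : Fin k → ℝ) :
    UnitAddTorus.mFourier h (toUnitTorus x)
      = Complex.exp (Complex.I * ((∑ i, 2 * Real.pi * h i * x i : ℝ) : ℂ)) := by
  simp only [UnitAddTorus.mFourier, ContinuousMap.coe_mk, toUnitTorus, fourier_coe_apply]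
  rw [← Complex.exp_sum]
  congr 1
  push_cast
  rw [Finset.mul_sum]
  refine Finset.sum_congr rfl fun i _ => ?_
  ring

lemma integral_Ioo_fourier {n : ℤ} (hn : n ≠ 0) :
    ∫ x in Set.Ioo (0 : ℝ) 1, fourier n (x : UnitAddCircle) = 0 := by
  rw [← integral_Ioc_eq_integral_Ioo, ← intervalIntegral.integral_of_le zero_le_one]
  have hder : ∀ x ∈ Set.uIcc (0 : ℝ) 1, HasDerivAt
      (fun y : ℝ => (1 : ℝ) / (-2 * Real.pi * Complex.I * (-n)) * fourier n (y : UnitAddCircle))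
      (fourier n (x : UnitAddCircle)) x := by
    intro x _
    have h := (hasDerivAt_fourier 1 n x).const_mul
      ((1 : ℝ) / (-2 * Real.pi * Complex.I * (-n) : ℂ))
    refine h.congr_deriv ?_
    have h1 : (n : ℂ) ≠ 0 := by exact_mod_cast hn
    have h2 : (Real.pi : ℂ) ≠ 0 := by exact_mod_cast Real.pi_ne_zero
    have h3 := Complex.I_ne_zero
    push_cast
    field_simp
  rw [intervalIntegral.integral_eq_sub_of_hasDerivAt hder]
  · have : ((1 : ℝ) : UnitAddCircle) = ((0 : ℝ) : UnitAddCircle) := by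
      simp
    rw [this, sub_self]
  · exact ((fourier n).continuous.comp (AddCircle.continuous_mk' (1 : ℝ))).intervalIntegrable _ _

lemma integral_mFourier_toUnitTorus {k : ℕ} {h : Fin k → ℤ} (hh : h ≠ 0) :
    ∫ x, UnitAddTorus.mFourier h (toUnitTorus x) ∂unitCubeMeasure k = 0 := by
  obtain ⟨i, hi⟩ := Function.ne_iff.1 hh
  rw [unitCubeMeasure_eq_pi]
  simp only [UnitAddTorus.mFourier, ContinuousMap.coe_mk, toUnitTorus]
  rw [integral_fintype_prod_eq_prod (fun (i : Fin k) (y : ℝ) => fourier (h i) (y : UnitAddCircle))]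
  exact Finset.prod_eq_zero (Finset.mem_univ i) (integral_Ioo_fourier hi)

lemma norm_average_le {C : ℝ} (hC : 0 ≤ C) {v : ℕ → ℂ} (hv : ∀ n, ‖v n‖ ≤ C) (N : ℕ) :
    ‖(∑ n ∈ Finset.Icc 1 N, v n) / ((N : ℝ) : ℂ)‖ ≤ C := by
  rw [norm_div, Complex.norm_real, Real.norm_natCast]
  refine div_le_of_le_mul₀ N.cast_nonneg hC ?_
  refine (norm_sum_le _ _).trans ((Finset.sum_le_sum fun n _ => hv n).trans ?_)
  simp [mul_comm]

lemma integrable_comp_toUnitTorus {k : ℕ} (g : C(UnitAddTorus (Fin k), ℂ)) :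
    Integrable (fun x => g (toUnitTorus x)) (unitCubeMeasure k) :=
  Integrable.of_bound (g.continuous.comp continuous_toUnitTorus).aestronglyMeasurable ‖g‖
    (Eventually.of_forall fun _ => g.norm_coe_le_norm _)

/-- Decay of the exponential sums gives convergence of the averages of all continuous functions
on the torus, because trigonometric polynomials are uniformly dense. -/
theorem tendsto_average_continuousMap {k : ℕ} {y : ℕ → UnitAddTorus (Fin k)}
    (hy : ∀ h : Fin k → ℤ, h ≠ 0 → Tendsto
      (fun N : ℕ => (∑ n ∈ Finset.Icc 1 N, UnitAddTorus.mFourier h (y n)) / ((N : ℝ) : ℂ))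
      atTop (𝓝 0)) (g : C(UnitAddTorus (Fin k), ℂ)) :
    Tendsto (fun N : ℕ => (∑ n ∈ Finset.Icc 1 N, g (y n)) / ((N : ℝ) : ℂ)) atTop
      (𝓝 (∫ x, g (toUnitTorus x) ∂unitCubeMeasure k)) := by
  have hspan : ∀ p ∈ Submodule.span ℂ (Set.range (UnitAddTorus.mFourier (d := Fin k))),
      Tendsto (fun N : ℕ => (∑ n ∈ Finset.Icc 1 N, p (y n)) / ((N : ℝ) : ℂ)) atTop
        (𝓝 (∫ x, p (toUnitTorus x) ∂unitCubeMeasure k)) := by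
    intro p hp
    induction hp using Submodule.span_induction with
    | mem p hp =>
      obtain ⟨h, rfl⟩ := hp
      by_cases hh : h = 0
      · subst hh
        rw [UnitAddTorus.mFourier_zero]
        simp only [ContinuousMap.one_apply, integral_const, probReal_univ, one_smul]
        refine tendsto_const_nhds.congr' ?_
        filter_upwards [eventually_gt_atTop 0] with N hN
        have : (N : ℂ) ≠ 0 := by exact_mod_cast hN.ne'
        simp [this]
      · rw [integral_mFourier_toUnitTorus hh]
        exact hy h hh
    | zero => simp
    | add p q _ _ hp hq =>
      simp only [ContinuousMap.add_apply]
      rw [integral_add (integrable_comp_toUnitTorus p) (integrable_comp_toUnitTorus q)]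
      refine (hp.add hq).congr fun N => ?_
      rw [Finset.sum_add_distrib, add_div]
    | smul a p _ hp =>
      simp only [ContinuousMap.smul_apply, smul_eq_mul]
      rw [integral_const_mul]
      refine (hp.const_mul a).congr fun N => ?_
      rw [← Finset.mul_sum, mul_div_assoc]
  have hmem : g ∈ closure ((Submodule.span ℂ
      (Set.range (UnitAddTorus.mFourier (d := Fin k))) :
        Submodule ℂ C(UnitAddTorus (Fin k), ℂ)) : Set C(UnitAddTorus (Fin k), ℂ)) := by
    rw [← Submodule.topologicalClosure_coe, UnitAddTorus.span_mFourier_closure_eq_top]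
    trivial
  rw [Metric.tendsto_atTop]
  intro ε hε
  obtain ⟨p, hp, hgp⟩ := Metric.mem_closure_iff.1 hmem (ε / 4) (by positivity)
  obtain ⟨N₀, hN₀⟩ := Metric.tendsto_atTop.1 (hspan p hp) (ε / 4) (by positivity)
  refine ⟨N₀, fun N hN => ?_⟩
  have hpt : ∀ t, ‖(g - p) t‖ ≤ ε / 4 := fun t =>
    ((g - p).norm_coe_le_norm t).trans (by rw [← dist_eq_norm]; exact hgp.le)
  have h1 : dist ((∑ n ∈ Finset.Icc 1 N, g (y n)) / ((N : ℝ) : ℂ))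
      ((∑ n ∈ Finset.Icc 1 N, p (y n)) / ((N : ℝ) : ℂ)) ≤ ε / 4 := by
    rw [dist_eq_norm, ← sub_div, ← Finset.sum_sub_distrib]
    exact norm_average_le (by positivity) (fun n => hpt (y n)) N
  have h2 : dist (∫ x, p (toUnitTorus x) ∂unitCubeMeasure k)
      (∫ x, g (toUnitTorus x) ∂unitCubeMeasure k) ≤ ε / 4 := by
    rw [dist_comm, dist_eq_norm,
      ← integral_sub (integrable_comp_toUnitTorus g) (integrable_comp_toUnitTorus p)]
    have := norm_integral_le_of_norm_le_const (μ := unitCubeMeasure k)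
      (f := fun x => g (toUnitTorus x) - p (toUnitTorus x))
      (Eventually.of_forall fun x => hpt (toUnitTorus x))
    simpa using this
  have h3 := hN₀ N hN
  have := dist_triangle4 ((∑ n ∈ Finset.Icc 1 N, g (y n)) / ((N : ℝ) : ℂ))
    ((∑ n ∈ Finset.Icc 1 N, p (y n)) / ((N : ℝ) : ℂ))
    (∫ x, p (toUnitTorus x) ∂unitCubeMeasure k) (∫ x, g (toUnitTorus x) ∂unitCubeMeasure k)
  linarith

/-- The representative in `[0, 1)ᵏ` of a point of the torus. -/
noncomputable def torusRep {k : ℕ} (t : UnitAddTorus (Fin k)) : Fin k → ℝ :=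
  fun i => (AddCircle.equivIco 1 0 (t i) : ℝ)

lemma torusRep_toUnitTorus {k : ℕ} (x : Fin k → ℝ) :
    torusRep (toUnitTorus x) = fun i => Int.fract (x i) := by
  funext i
  simp only [torusRep, toUnitTorus]
  rw [AddCircle.coe_equivIco_mk_apply]
  simp

lemma continuousAt_torusRep_toUnitTorus {k : ℕ} {x : Fin k → ℝ}
    (hx : ∀ i, x i ∈ Set.Ioo (0 : ℝ) 1) : ContinuousAt torusRep (toUnitTorus x) := by
  refine continuousAt_pi.2 fun i => ?_
  have hne : toUnitTorus x i ≠ ((0 : ℝ) : UnitAddCircle) := by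
    intro h
    have := (AddCircle.coe_eq_zero_iff_of_mem_Ico (p := (1 : ℝ)) ⟨(hx i).1.le, (hx i).2⟩).1
      (by simpa [toUnitTorus] using h)
    exact (hx i).1.ne' this
  have h1 : ContinuousAt (fun s : UnitAddCircle => (AddCircle.equivIco 1 0 s : ℝ))
      (toUnitTorus x i) :=
    continuousAt_subtype_val.comp (AddCircle.continuousAt_equivIco 1 0 hne)
  exact h1.comp (f := fun t : UnitAddTorus (Fin k) => t i) (continuous_apply i).continuousAt

/-- A box is a continuity set of the limiting distribution on the torus. -/
lemma map_unitCubeMeasure_frontier_eq_zero {k : ℕ} {B : Set (Fin k → ℝ)} (hB : Convex ℝ B) :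
    (unitCubeMeasure k).map toUnitTorus (frontier (torusRep ⁻¹' B)) = 0 := by
  rw [Measure.map_apply continuous_toUnitTorus.measurable isClosed_frontier.measurableSet]
  have h1 : ∀ᵐ x ∂unitCubeMeasure k, x ∈ Set.univ.pi fun _ : Fin k => Set.Ioo (0 : ℝ) 1 :=
    ae_restrict_mem (MeasurableSet.univ_pi fun _ => measurableSet_Ioo)
  have h2 : ∀ᵐ x ∂unitCubeMeasure k, x ∉ frontier B :=
    ae_restrict_of_ae (measure_eq_zero_iff_ae_notMem.1 (hB.addHaar_frontier volume))
  refine measure_eq_zero_iff_ae_notMem.2 ?_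
  filter_upwards [h1, h2] with x hx1 hx2 hx3
  have hx1' : ∀ i, x i ∈ Set.Ioo (0 : ℝ) 1 := fun i => hx1 i (Set.mem_univ i)
  have hrep : torusRep (toUnitTorus x) = x := by
    rw [torusRep_toUnitTorus]
    exact funext fun i => Int.fract_eq_self.2 ⟨(hx1' i).1.le, (hx1' i).2⟩
  have hcont := continuousAt_torusRep_toUnitTorus hx1'
  rw [ContinuousAt, hrep] at hcont
  obtain ⟨hx3c, hx3i⟩ := hx3
  by_cases hin : x ∈ interior B
  · exact hx3i (mem_interior_iff_mem_nhds.2 (hcont (mem_interior_iff_mem_nhds.1 hin)))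
  · have hcl : x ∈ (closure B)ᶜ := fun h => hx2 ⟨h, hin⟩
    have : Bᶜ ∈ 𝓝 x := mem_of_superset (isClosed_closure.isOpen_compl.mem_nhds hcl)
      (Set.compl_subset_compl.2 subset_closure)
    obtain ⟨t, ht1, ht2⟩ := mem_closure_iff_nhds.1 hx3c _ (hcont this)
    exact ht1 ht2

/-- The uniform distribution on the first `N + 1` terms `y 1, …, y (N + 1)` of a sequence. -/
noncomputable def empiricalMeasure {Ω : Type*} [MeasurableSpace Ω] (y : ℕ → Ω) (N : ℕ) : Measure Ω :=
  ((N + 1 : ℕ) : ENNReal)⁻¹ • ∑ n ∈ Finset.Icc 1 (N + 1), Measure.dirac (y n)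

instance isProbabilityMeasure_empiricalMeasure {Ω : Type*} [MeasurableSpace Ω] (y : ℕ → Ω)
    (N : ℕ) : IsProbabilityMeasure (empiricalMeasure y N) :=
  ⟨by
    simp only [empiricalMeasure, Measure.smul_apply, Measure.finsetSum_apply, measure_univ,
      Finset.sum_const, Nat.card_Icc, nsmul_eq_mul, smul_eq_mul, mul_one, add_tsub_cancel_right]
    exact ENNReal.inv_mul_cancel (by simp) (ENNReal.natCast_ne_top _)⟩

/-- The sufficiency half of Weyl's criterion, for boxes: the empirical measures converge weakly on the
torus, and the portmanteau theorem applies since boxes are continuity sets of the limit. -/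
theorem isUniformlyDistributedModOne_of_tendsto {k : ℕ} {x : ℕ → Fin k → ℝ}
    (hx : ∀ h : Fin k → ℤ, h ≠ 0 → Tendsto
      (fun N : ℕ => (∑ n ∈ Finset.Icc 1 N,
        Complex.exp (Complex.I * ((∑ i, 2 * Real.pi * h i * x n i : ℝ) : ℂ))) / ((N : ℝ) : ℂ))
      atTop (𝓝 0)) :
    IsUniformlyDistributedModOne x := by
  intro I hI
  set y : ℕ → UnitAddTorus (Fin k) := fun n => toUnitTorus (x n) with hy
  set B := Set.univ.pi I with hB
  have hBconv : Convex ℝ B := convex_pi fun i _ => (hI i).1.convex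
  have hBsub : B ⊆ Set.Icc 0 1 := fun z hz =>
    ⟨fun i => ((hI i).2 (hz i (Set.mem_univ i))).1, fun i => ((hI i).2 (hz i (Set.mem_univ i))).2⟩
  have hav := tendsto_average_continuousMap (y := y) fun h hh => by
    simpa only [hy, mFourier_toUnitTorus] using hx h hh
  have hprob : IsProbabilityMeasure ((unitCubeMeasure k).map toUnitTorus) :=
    Measure.isProbabilityMeasure_map continuous_toUnitTorus.aemeasurable
  let ν : ProbabilityMeasure (UnitAddTorus (Fin k)) := ⟨(unitCubeMeasure k).map toUnitTorus, hprob⟩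
  let μ : ℕ → ProbabilityMeasure (UnitAddTorus (Fin k)) := fun N =>
    ⟨empiricalMeasure y N, isProbabilityMeasure_empiricalMeasure y N⟩
  have hweak : Tendsto μ atTop (𝓝 ν) := by
    rw [ProbabilityMeasure.tendsto_iff_forall_integral_tendsto]
    intro g
    have h1 := hav ⟨fun t => ((g t : ℝ) : ℂ), Complex.continuous_ofReal.comp g.continuous⟩
    have h2 := ((Complex.continuous_re.tendsto _).comp h1).comp (tendsto_add_atTop_nat 1)
    simp only [ContinuousMap.coe_mk] at h2
    rw [integral_complex_ofReal, Complex.ofReal_re] at h2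
    have e : ∫ t, g t ∂(ν : Measure (UnitAddTorus (Fin k)))
        = ∫ z, g (toUnitTorus z) ∂unitCubeMeasure k :=
      integral_map continuous_toUnitTorus.aemeasurable g.continuous.aestronglyMeasurable
    rw [e]
    refine h2.congr fun N => ?_
    have e2 : ∫ t, g t ∂(μ N : Measure (UnitAddTorus (Fin k)))
        = ((N + 1 : ℕ) : ℝ)⁻¹ * ∑ n ∈ Finset.Icc 1 (N + 1), g (y n) := by
      change ∫ t, g t ∂(empiricalMeasure y N) = _
      rw [empiricalMeasure, integral_smul_measure, integral_finsetSum_measure]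
      · rw [ENNReal.toReal_inv, ENNReal.toReal_natCast]
        simp [integral_dirac]
      · intro n _
        exact g.integrable _
    rw [e2]
    simp only [Function.comp]
    rw [← Complex.ofReal_sum, ← Complex.ofReal_div, Complex.ofReal_re]
    ring
  have hfr : (ν : Measure (UnitAddTorus (Fin k))) (frontier (torusRep ⁻¹' B)) = 0 :=
    map_unitCubeMeasure_frontier_eq_zero hBconv
  have hlim := ProbabilityMeasure.tendsto_measure_of_null_frontier_of_tendsto' hweak hfr
  have hνB : (ν : Measure (UnitAddTorus (Fin k))) (torusRep ⁻¹' B) = volume B := by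
    change (unitCubeMeasure k).map toUnitTorus (torusRep ⁻¹' B) = _
    rw [Measure.map_apply₀ continuous_toUnitTorus.aemeasurable
      (nullMeasurableSet_of_null_frontier hfr), ← unitCubeMeasure_apply_of_subset hBsub]
    refine measure_congr ?_
    filter_upwards [ae_restrict_mem (μ := volume) (MeasurableSet.univ_pi
      fun _ : Fin k => measurableSet_Ioo (a := (0 : ℝ)) (b := 1))] with z hz
    have hrep : torusRep (toUnitTorus z) = z := by
      rw [torusRep_toUnitTorus]
      exact funext fun i => Int.fract_eq_self.2
        ⟨(hz i (Set.mem_univ i)).1.le, (hz i (Set.mem_univ i)).2⟩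
    change (torusRep (toUnitTorus z) ∈ B) = (z ∈ B)
    rw [hrep]
  rw [hνB] at hlim
  have hfin : volume B ≠ ⊤ := by
    rw [← unitCubeMeasure_apply_of_subset hBsub]
    exact measure_ne_top _ _
  have hreal := (ENNReal.tendsto_toReal hfin).comp hlim
  refine (tendsto_add_atTop_iff_nat 1).1 (hreal.congr fun N => ?_)
  classical
  have hset : {n : ℕ | n ∈ Set.Icc 1 (N + 1) ∧ (fun i => Int.fract (x n i)) ∈ B}
      = ((Finset.Icc 1 (N + 1)).filter fun n => y n ∈ torusRep ⁻¹' B : Finset ℕ) := by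
    ext n
    simp only [Set.mem_ofPred_eq, Set.mem_Icc, Finset.coe_filter, Finset.mem_Icc, Set.mem_preimage,
      hy, torusRep_toUnitTorus]
  rw [hset, Set.ncard_coe_finset]
  have hE : (empiricalMeasure y N) (torusRep ⁻¹' B) = ((N + 1 : ℕ) : ENNReal)⁻¹ *
      ((Finset.Icc 1 (N + 1)).filter fun n => y n ∈ torusRep ⁻¹' B).card := by
    rw [empiricalMeasure, Measure.smul_apply, Measure.finsetSum_apply, smul_eq_mul,
      Finset.card_filter]
    congr 1
    push_cast
    refine Finset.sum_congr rfl fun n _ => ?_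
    rw [Measure.dirac_apply, Set.indicator_apply]
    rfl
  change ((empiricalMeasure y N) (torusRep ⁻¹' B)).toReal = _
  rw [hE, ENNReal.toReal_mul, ENNReal.toReal_inv, ENNReal.toReal_natCast, ENNReal.toReal_natCast,
    one_div]

/-! ### Second moments of exponential sums over scattered sequences -/

lemma sum_sum_Icc_eq_of_symm {T : ℕ → ℕ → ℝ} (hsymm : ∀ n m, T n m = T m n)
    (hdiag : ∀ n, T n n = 1) (N : ℕ) :
    ∑ n ∈ Finset.Icc 1 N, ∑ m ∈ Finset.Icc 1 N, T n m
      = N + 2 * ∑ n ∈ Finset.Icc 1 N, ∑ m ∈ Finset.Ico 1 n, T n m := by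
  induction N with
  | zero => simp
  | succ N ih =>
    simp only [Finset.sum_Icc_succ_top (Nat.le_add_left 1 N), Finset.sum_add_distrib]
    rw [ih, hdiag, Finset.sum_congr rfl fun n _ => hsymm n (N + 1),
      show Finset.Ico 1 (N + 1) = Finset.Icc 1 N from rfl]
    push_cast
    ring

/-- Expanding the square reduces the second moment of a sum to the correlations of its terms. -/
lemma integral_norm_sum_sq_le {α : Type*} [MeasurableSpace α] {μ : Measure α} [IsFiniteMeasure μ]
    {u : ℕ → α → ℂ} (hu : ∀ n, Measurable (u n)) (hu1 : ∀ n x, ‖u n x‖ ≤ 1) {b : ℕ → ℕ → ℝ}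
    (hb : ∀ n m, ‖∫ x, u n x * starRingEnd ℂ (u m x) ∂μ‖ ≤ b n m) (s : Finset ℕ) :
    ∫ x, ‖∑ n ∈ s, u n x‖ ^ 2 ∂μ ≤ ∑ n ∈ s, ∑ m ∈ s, b n m := by
  have hint : ∀ n m, Integrable (fun x => u n x * starRingEnd ℂ (u m x)) μ := fun n m =>
    Integrable.of_bound ((hu n).mul (Complex.continuous_conj.measurable.comp
      (hu m))).aestronglyMeasurable 1 (Eventually.of_forall fun x => by
        rw [norm_mul, RCLike.norm_conj]
        exact mul_le_one₀ (hu1 n x) (norm_nonneg _) (hu1 m x))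
  have hexp : ∀ x, ((‖∑ n ∈ s, u n x‖ ^ 2 : ℝ) : ℂ)
      = ∑ n ∈ s, ∑ m ∈ s, u n x * starRingEnd ℂ (u m x) := by
    intro x
    rw [Complex.ofReal_pow, ← Complex.mul_conj', map_sum, Finset.sum_mul_sum]
  have hI : ((∫ x, ‖∑ n ∈ s, u n x‖ ^ 2 ∂μ : ℝ) : ℂ)
      = ∑ n ∈ s, ∑ m ∈ s, ∫ x, u n x * starRingEnd ℂ (u m x) ∂μ := by
    rw [← integral_complex_ofReal]
    simp only [hexp]
    rw [integral_finsetSum _ fun n _ => integrable_finsetSum _ fun m _ => hint n m]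
    exact Finset.sum_congr rfl fun n _ => integral_finsetSum _ fun m _ => hint n m
  calc ∫ x, ‖∑ n ∈ s, u n x‖ ^ 2 ∂μ = ‖((∫ x, ‖∑ n ∈ s, u n x‖ ^ 2 ∂μ : ℝ) : ℂ)‖ := by
        rw [Complex.norm_real, Real.norm_of_nonneg (integral_nonneg fun x => by positivity)]
    _ ≤ _ := by
        rw [hI]
        exact (norm_sum_le _ _).trans (Finset.sum_le_sum fun n _ =>
          (norm_sum_le _ _).trans (Finset.sum_le_sum fun m _ => hb n m))

lemma eventually_log_rpow_le_natCast (p : ℝ) :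
    ∀ᶠ N : ℕ in atTop, Real.log (N : ℝ) ^ p ≤ N := by
  have h := (isLittleO_log_rpow_rpow_atTop p one_pos).bound one_pos
  filter_upwards [tendsto_natCast_atTop_atTop.eventually h] with N hN
  rw [one_mul, Real.rpow_one, Real.norm_natCast] at hN
  exact (le_abs_self _).trans hN

lemma truncInvPow_abs_sub_self (δ : ℝ) (t : ℝ) : truncInvPow δ |t - t| = 1 := by
  simp [truncInvPow]

/-- Terms whose correlations are controlled by a scattered sequence have averages tending to zero
almost everywhere. -/
theorem ae_tendsto_average_of_isDeltaScattered {α : Type*} [MeasurableSpace α] {μ : Measure α}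
    [IsFiniteMeasure μ] {u : ℕ → α → ℂ} (hu : ∀ n, Measurable (u n)) (hu1 : ∀ n x, ‖u n x‖ ≤ 1)
    {a : ℕ → ℝ} {δ K : ℝ} (hK : 0 < K) (ha : IsDeltaScattered δ a)
    (hb : ∀ n m, ‖∫ x, u n x * starRingEnd ℂ (u m x) ∂μ‖ ≤ K * truncInvPow δ |a n - a m|) :
    ∀ᵐ x ∂μ, Tendsto (fun N : ℕ => (∑ n ∈ Finset.Icc 1 N, u n x) / ((N : ℝ) : ℂ))
      atTop (𝓝 0) := by
  obtain ⟨ε, hε, hsc⟩ := ha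
  refine ae_tendsto_average_of_integral_norm_sq_le hu hu1 (C := 3 * K) hε ?_
  filter_upwards [hsc, eventually_log_rpow_le_natCast (1 + ε), eventually_gt_atTop 1]
    with N hN hlog hN1
  have hN0 : (0 : ℝ) < N := by exact_mod_cast (by omega : 0 < N)
  have hlogpos : 0 < Real.log (N : ℝ) ^ (1 + ε) :=
    Real.rpow_pos_of_pos (Real.log_pos (by exact_mod_cast hN1)) _
  have hsq : ∀ x, ‖(∑ n ∈ Finset.Icc 1 N, u n x) / ((N : ℝ) : ℂ)‖ ^ 2
      = 1 / (N : ℝ) ^ 2 * ‖∑ n ∈ Finset.Icc 1 N, u n x‖ ^ 2 := by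
    intro x
    rw [norm_div, Complex.norm_real, Real.norm_natCast, div_pow]
    ring
  simp only [hsq]
  rw [integral_const_mul]
  have hmom := integral_norm_sum_sq_le hu hu1 hb (Finset.Icc 1 N)
  simp only [← Finset.mul_sum] at hmom
  rw [sum_sum_Icc_eq_of_symm (fun n m => by rw [abs_sub_comm])
    (fun n => truncInvPow_abs_sub_self δ _)] at hmom
  set W := ∑ n ∈ Finset.Icc 1 N, ∑ m ∈ Finset.Ico 1 n, truncInvPow δ |a n - a m|
  have h1 : 1 / (N : ℝ) ≤ 1 / Real.log N ^ (1 + ε) :=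
    one_div_le_one_div_of_le hlogpos hlog
  calc 1 / (N : ℝ) ^ 2 * ∫ x, ‖∑ n ∈ Finset.Icc 1 N, u n x‖ ^ 2 ∂μ
      ≤ 1 / (N : ℝ) ^ 2 * (K * (N + 2 * W)) := by gcongr
    _ = K * (1 / N + 2 * (1 / (N : ℝ) ^ 2 * W)) := by field_simp
    _ ≤ K * (1 / Real.log N ^ (1 + ε) + 2 * (1 / Real.log N ^ (1 + ε))) := by gcongr
    _ = _ := by ring

/-- The exponential sum attached to a nonzero frequency vector has vanishing averages almost
everywhere. -/
theorem ae_tendsto_average_cexp {k : ℕ} {f : Fin k → ℝ → ℝ}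
    (hf : ∀ i, AnalyticOnNhd ℝ (f i) Set.univ)
    (hind : LinearIndependent ℝ (Fin.cons (fun _ => 1) f : Fin (k + 1) → ℝ → ℝ))
    {a : Fin k → ℕ → ℝ} (ha : ∀ i, IsScattered (a i)) {h : Fin k → ℤ} (hh : h ≠ 0) :
    ∀ᵐ x : ℝ, Tendsto (fun N : ℕ => (∑ n ∈ Finset.Icc 1 N,
        Complex.exp (Complex.I * ((∑ i, 2 * Real.pi * h i * (a i n * f i x) : ℝ) : ℂ)))
          / ((N : ℝ) : ℂ)) atTop (𝓝 0) := by
  set u : ℕ → ℝ → ℂ := fun n x =>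
    Complex.exp (Complex.I * ((∑ i, 2 * Real.pi * h i * (a i n * f i x) : ℝ) : ℂ)) with hu
  have hfc : ∀ i, Continuous (f i) := fun i => continuous_iff_continuousAt.2 fun x =>
    (hf i x (Set.mem_univ x)).continuousAt
  have hum : ∀ n, Measurable (u n) := fun n => by
    have : Continuous (u n) := by rw [hu]; fun_prop
    exact this.measurable
  have hu1 : ∀ n x, ‖u n x‖ ≤ 1 := fun n x => by
    rw [hu]; simp only; rw [mul_comm]; exact (Complex.norm_exp_ofReal_mul_I _).le
  obtain ⟨i, hi⟩ := Function.ne_iff.1 hh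
  refine measure_null_of_locally_null _ fun x₀ _ => ?_
  obtain ⟨ρ, δ, K, hρ, hδ, hδ1, hK, hosc⟩ :=
    exists_norm_integral_cexp_sum_le_truncInvPow hf hind x₀
  have hcorr : ∀ n m, ‖∫ x, u n x * starRingEnd ℂ (u m x)
      ∂volume.restrict (Set.Ioc (x₀ - ρ) (x₀ + ρ))‖ ≤ K * truncInvPow δ |a i n - a i m| := by
    intro n m
    set c : Fin k → ℝ := fun i => 2 * Real.pi * h i * (a i n - a i m) with hc
    have e : ∀ x, u n x * starRingEnd ℂ (u m x)
        = Complex.exp (Complex.I * (∑ i, c i * f i x : ℝ)) := by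
      intro x
      rw [hu]
      simp only
      rw [← Complex.exp_conj, map_mul, Complex.conj_I, Complex.conj_ofReal, ← Complex.exp_add]
      congr 1
      rw [neg_mul, ← sub_eq_add_neg, ← mul_sub, ← Complex.ofReal_sub, ← Finset.sum_sub_distrib]
      congr 3
      funext j
      rw [hc]
      ring
    simp only [e]
    rw [← intervalIntegral.integral_of_le (by linarith)]
    refine hosc c _ (abs_nonneg _) (le_trans ?_ (norm_le_pi_norm c i))
    rw [hc, Real.norm_eq_abs, abs_mul, abs_mul, abs_of_pos Real.two_pi_pos]
    refine le_mul_of_one_le_left (abs_nonneg _) ?_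
    have h1 : (1 : ℝ) ≤ |(h i : ℝ)| := by exact_mod_cast Int.one_le_abs hi
    have h2 := Real.pi_gt_three
    nlinarith
  have hae := ae_tendsto_average_of_isDeltaScattered (μ := volume.restrict
    (Set.Ioc (x₀ - ρ) (x₀ + ρ))) hum hu1 hK (ha i δ hδ hδ1) hcorr
  rw [ae_restrict_iff' measurableSet_Ioc] at hae
  refine ⟨_, inter_mem self_mem_nhdsWithin (mem_nhdsWithin_of_mem_nhds
    (Ioc_mem_nhds (by linarith : x₀ - ρ < x₀) (by linarith : x₀ < x₀ + ρ))), ?_⟩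
  refine measure_mono_null ?_ hae
  rintro x ⟨hx1, hx2⟩ hx3
  exact hx1 (hx3 hx2)

/-! ### Linear relations obstruct uniform distribution -/

lemma isScattered_mul_two_pow {c : ℝ} (hc : c ≠ 0) : IsScattered fun n => c * 2 ^ n := by
  intro δ hδ _
  refine ⟨1, one_pos, ?_⟩
  set q : ℝ := (2 : ℝ) ^ (-δ) with hq
  have hq0 : 0 < q := by positivity
  have hq1 : q < 1 := Real.rpow_lt_one_of_one_lt_of_neg one_lt_two (by linarith)
  set A : ℝ := (|c| / 2) ^ (-δ) with hA
  have hcpos : 0 < |c| := abs_pos.2 hc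
  have hA0 : 0 < A := by positivity
  have hterm : ∀ n, ∀ m ∈ Finset.Ico 1 n, truncInvPow δ |c * 2 ^ n - c * 2 ^ m| ≤ A * q ^ n := by
    intro n m hm
    have hmn := (Finset.mem_Ico.1 hm).2
    have hle : |c| / 2 * 2 ^ n ≤ |c * 2 ^ n - c * 2 ^ m| := by
      have h1 : (2 : ℝ) ^ (m + 1) ≤ 2 ^ n := pow_le_pow_right₀ one_le_two hmn
      rw [pow_succ] at h1
      rw [← mul_sub, abs_mul, div_mul_eq_mul_div, mul_div_assoc]
      gcongr
      exact le_trans (by linarith) (le_abs_self _)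
    have hpos : 0 < |c| / 2 * 2 ^ n := by positivity
    have hq' : A * q ^ n = (|c| / 2 * 2 ^ n) ^ (-δ) := by
      rw [Real.mul_rpow (by positivity) (by positivity), hA, hq, ← Real.rpow_natCast,
        ← Real.rpow_natCast, ← Real.rpow_mul zero_le_two, ← Real.rpow_mul zero_le_two, mul_comm (-δ)]
    rw [hq', truncInvPow, if_neg (by linarith)]
    exact (min_le_left _ _).trans (Real.rpow_le_rpow_of_nonpos hpos hle (by linarith))
  have hsummable : Summable fun n : ℕ => (n : ℝ) * q ^ n := by
    simpa using summable_pow_mul_geometric_of_norm_lt_one 1 (r := q)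
      (by rwa [Real.norm_of_nonneg hq0.le])
  set S := ∑' n : ℕ, (n : ℝ) * q ^ n
  have hsum : ∀ N, ∑ n ∈ Finset.Icc 1 N, ∑ m ∈ Finset.Ico 1 n,
      truncInvPow δ |c * 2 ^ n - c * 2 ^ m| ≤ A * S := by
    intro N
    calc _ ≤ ∑ n ∈ Finset.Icc 1 N, A * ((n : ℝ) * q ^ n) := by
          refine Finset.sum_le_sum fun n _ => (Finset.sum_le_sum (hterm n)).trans ?_
          rw [Finset.sum_const, Nat.card_Ico, nsmul_eq_mul]
          have : ((n - 1 : ℕ) : ℝ) ≤ n := by exact_mod_cast Nat.sub_le n 1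
          calc ((n - 1 : ℕ) : ℝ) * (A * q ^ n) ≤ n * (A * q ^ n) := by gcongr
            _ = _ := by ring
      _ ≤ A * S := by
          rw [← Finset.mul_sum]
          gcongr
          exact hsummable.sum_le_tsum _ fun n _ => by positivity
  filter_upwards [eventually_log_rpow_le_natCast (1 + 1),
    tendsto_natCast_atTop_atTop.eventually_ge_atTop (A * S), eventually_gt_atTop 1]
    with N hlog hNS hN1
  have hN0 : (0 : ℝ) < N := by exact_mod_cast (by omega : 0 < N)
  have hlogpos : 0 < Real.log (N : ℝ) ^ ((1 : ℝ) + 1) :=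
    Real.rpow_pos_of_pos (Real.log_pos (by exact_mod_cast hN1)) _
  calc _ ≤ 1 / (N : ℝ) ^ 2 * N := by
        gcongr
        exact (hsum N).trans hNS
    _ = 1 / N := by field_simp
    _ ≤ _ := one_div_le_one_div_of_le hlogpos hlog

/-- A sequence in which a fixed nonempty set of coordinates always sums to an integer is not
uniformly distributed: it never enters the open cube of side `1 / k` at the origin. -/
lemma not_isUniformlyDistributedModOne_of_sum_eq_intCast {k : ℕ} {x : ℕ → Fin k → ℝ}
    {s : Finset (Fin k)} (hs : s.Nonempty) (z : ℕ → ℤ) (hx : ∀ n, ∑ i ∈ s, x n i = z n) :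
    ¬ IsUniformlyDistributedModOne x := by
  intro hud
  have hk : 0 < k := by
    obtain ⟨i, -⟩ := hs
    exact i.pos
  have hk' : (0 : ℝ) < k := by exact_mod_cast hk
  have hlim := hud (fun _ => Set.Ioo 0 (1 / (k : ℝ))) fun i => ⟨Set.ordConnected_Ioo, fun y hy =>
    ⟨hy.1.le, hy.2.le.trans (by rw [div_le_one hk']; exact_mod_cast hk)⟩⟩
  have hempty : ∀ N : ℕ, {n : ℕ | n ∈ Set.Icc 1 N ∧ (fun i => Int.fract (x n i)) ∈
      Set.univ.pi fun _ : Fin k => Set.Ioo 0 (1 / (k : ℝ))} = ∅ := by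
    intro N
    refine Set.eq_empty_iff_forall_notMem.2 fun n hn => ?_
    have hn' : ∀ i, Int.fract (x n i) ∈ Set.Ioo 0 (1 / (k : ℝ)) := fun i => hn.2 i (Set.mem_univ i)
    have hint : ∑ i ∈ s, Int.fract (x n i) = ((z n - ∑ i ∈ s, ⌊x n i⌋ : ℤ) : ℝ) := by
      push_cast
      rw [← hx n, ← Finset.sum_sub_distrib]
      rfl
    have hpos : 0 < ∑ i ∈ s, Int.fract (x n i) := Finset.sum_pos (fun i _ => (hn' i).1) hs
    have hlt : ∑ i ∈ s, Int.fract (x n i) < 1 := by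
      calc ∑ i ∈ s, Int.fract (x n i) < ∑ _i ∈ s, 1 / (k : ℝ) :=
            Finset.sum_lt_sum_of_nonempty hs fun i _ => (hn' i).2
        _ = s.card / k := by rw [Finset.sum_const, nsmul_eq_mul]; ring
        _ ≤ 1 := by
          rw [div_le_one hk']
          exact_mod_cast (s.card_le_univ).trans_eq (Fintype.card_fin k)
    rw [hint] at hpos hlt
    have h1 : 0 < z n - ∑ i ∈ s, ⌊x n i⌋ := by exact_mod_cast hpos
    have h2 : z n - ∑ i ∈ s, ⌊x n i⌋ < 1 := by exact_mod_cast hlt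
    omega
  simp only [hempty, Set.ncard_empty, Nat.cast_zero, mul_zero] at hlim
  have hvol := tendsto_nhds_unique hlim tendsto_const_nhds
  rw [Real.volume_pi_Ioo_toReal (fun _ => by positivity)] at hvol
  have : (0 : ℝ) < ∏ _i : Fin k, (1 / (k : ℝ) - 0) :=
    Finset.prod_pos fun _ _ => by rw [sub_zero]; positivity
  linarith

/-- A linear relation with constants produces scattered sequences that violate uniform
distribution at every point. -/
theorem exists_isScattered_not_isUniformlyDistributedModOne {k : ℕ} {f : Fin k → ℝ → ℝ}
    (hdep : ¬ LinearIndependent ℝ (Fin.cons (fun _ => 1) f : Fin (k + 1) → ℝ → ℝ)) :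
    ∃ a : Fin k → ℕ → ℝ, (∀ i, IsScattered (a i)) ∧
      ∀ x, ¬ IsUniformlyDistributedModOne fun n i => a i n * f i x := by
  obtain ⟨g, hg, j, hj⟩ := Fintype.not_linearIndependent_iff.1 hdep
  have hrel : ∀ x, g 0 + ∑ i : Fin k, g i.succ * f i x = 0 := by
    intro x
    have := congrFun hg x
    simpa [Fin.sum_univ_succ] using this
  have hne : ∃ i : Fin k, g i.succ ≠ 0 := by
    by_contra! hcon
    have h0 : g 0 = 0 := by simpa [hcon] using hrel 0
    exact hj (Fin.cases h0 hcon j)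
  -- after rescaling, the constant term of the relation is an integer
  obtain ⟨r, hr, z, hz⟩ : ∃ r : ℝ, r ≠ 0 ∧ ∃ z : ℤ, r * g 0 = z := by
    by_cases h0 : g 0 = 0
    · exact ⟨1, one_ne_zero, 0, by simp [h0]⟩
    · exact ⟨(g 0)⁻¹, inv_ne_zero h0, 1, by simp [h0]⟩
  classical
  refine ⟨fun i n => (if g i.succ = 0 then 1 else r * g i.succ) * 2 ^ n, fun i => ?_, fun x => ?_⟩
  · apply isScattered_mul_two_pow
    split_ifs with h
    · exact one_ne_zero
    · exact mul_ne_zero hr h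
  · obtain ⟨i, hi⟩ := hne
    refine not_isUniformlyDistributedModOne_of_sum_eq_intCast
      (s := Finset.univ.filter fun i : Fin k => g i.succ ≠ 0) ⟨i, by simpa using hi⟩
      (fun n => -z * 2 ^ n) fun n => ?_
    have h1 : ∑ i : Fin k with g i.succ ≠ 0,
        (if g i.succ = 0 then 1 else r * g i.succ) * 2 ^ n * f i x
        = ∑ i : Fin k, r * 2 ^ n * (g i.succ * f i x) := by
      rw [Finset.sum_filter]
      refine Finset.sum_congr rfl fun i _ => ?_
      by_cases h : g i.succ = 0
      · simp [h]
      · simp only [ne_eq, h, not_false_eq_true, if_true, if_false]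
        ring
    have h2 : ∑ i : Fin k, g i.succ * f i x = -g 0 := by linarith [hrel x]
    rw [h1, ← Finset.mul_sum, h2]
    push_cast
    rw [← hz]
    ring

/-! ### The equivalence for analytic functions and for polynomials -/

theorem linearIndependent_iff_forall_isScattered {k : ℕ} {f : Fin k → ℝ → ℝ}
    (hf : ∀ i, AnalyticOnNhd ℝ (f i) Set.univ) :
    LinearIndependent ℝ (Fin.cons (fun _ => 1) f : Fin (k + 1) → ℝ → ℝ) ↔
      ∀ a : Fin k → ℕ → ℝ, (∀ i, IsScattered (a i)) →
        ∀ᵐ x : ℝ ∂volume, IsUniformlyDistributedModOne (fun n i => a i n * f i x) := by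
  constructor
  · intro hind a ha
    have hall : ∀ᵐ x : ℝ, ∀ h : Fin k → ℤ, h ≠ 0 → Tendsto (fun N : ℕ => (∑ n ∈ Finset.Icc 1 N,
        Complex.exp (Complex.I * ((∑ i, 2 * Real.pi * h i * (a i n * f i x) : ℝ) : ℂ)))
          / ((N : ℝ) : ℂ)) atTop (𝓝 0) := by
      refine ae_all_iff.2 fun h => ?_
      by_cases hh : h = 0
      · exact Eventually.of_forall fun x h' => absurd hh h'
      · filter_upwards [ae_tendsto_average_cexp hf hind ha hh] with x hx _ using hx
    filter_upwards [hall] with x hx using isUniformlyDistributedModOne_of_tendsto hx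
  · intro hud
    by_contra hdep
    obtain ⟨a, ha, hnot⟩ := exists_isScattered_not_isUniformlyDistributedModOne hdep
    obtain ⟨x, hx⟩ := (hud a ha).exists
    exact hnot x hx

lemma linearIndependent_cons_one_polynomial_iff {k : ℕ} (p : Fin k → Polynomial ℝ) :
    LinearIndependent ℝ (Fin.cons 1 p : Fin (k + 1) → Polynomial ℝ) ↔
      LinearIndependent ℝ
        (Fin.cons (fun _ => 1) (fun i x => (p i).eval x) : Fin (k + 1) → ℝ → ℝ) := by
  let L : Polynomial ℝ →ₗ[ℝ] ℝ → ℝ := LinearMap.pi fun x => Polynomial.leval x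
  have hL : LinearMap.ker L = ⊥ := LinearMap.ker_eq_bot.2 fun p q h =>
    Polynomial.funext fun x => congrFun h x
  rw [← LinearMap.linearIndependent_iff L hL]
  have : L ∘ (Fin.cons 1 p : Fin (k + 1) → Polynomial ℝ)
      = Fin.cons (fun _ => 1) (fun i x => (p i).eval x) := by
    funext j x
    refine Fin.cases ?_ (fun i => ?_) j <;> simp [L]
  rw [this]

theorem mainTheorem2 (k : ℕ) (hk : 1 ≤ k) :
    (∀ f : Fin k → ℝ → ℝ, (∀ i, AnalyticOnNhd ℝ (f i) Set.univ) →
      (LinearIndependent ℝ (Fin.cons (fun _ => 1) f : Fin (k + 1) → ℝ → ℝ) ↔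
        ∀ a : Fin k → ℕ → ℝ, (∀ i, IsScattered (a i)) →
          ∀ᵐ x : ℝ ∂volume, IsUniformlyDistributedModOne (fun n i => a i n * f i x))) ∧
    (∀ p : Fin k → Polynomial ℝ,
      (LinearIndependent ℝ (Fin.cons 1 p : Fin (k + 1) → Polynomial ℝ) ↔
        ∀ a : Fin k → ℕ → ℝ, (∀ i, IsScattered (a i)) →
          ∀ᵐ x : ℝ ∂volume,
            IsUniformlyDistributedModOne (fun n i => a i n * (p i).eval x))) := by
  refine ⟨fun f hf => linearIndependent_iff_forall_isScattered hf, fun p => ?_⟩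
  rw [linearIndependent_cons_one_polynomial_iff]
  exact linearIndependent_iff_forall_isScattered fun i =>
    AnalyticOnNhd.aeval_polynomial analyticOnNhd_id (p i)
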